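/- A symmetric tricocycloid is a set $H$ with binary operations $\bullet,\circ,\bullet^{-1},\circ^{-1}$ and a unary operation $(-)^*$ such that, for all $p,q,r\in H$: $p^{**}=p$; $(p\bullet q)\bullet^{-1}(p\circ q)=p$; $(p\bullet q)\circ^{-1}(p\circ q)=q$; $(p\bullet q)^*\bullet(p\circ q)=p\bullet q^*$; $(p\bullet q)^*\circ(p\circ q)=(p\circ q^*)^*$; $p\bullet(q\bullet r)=(p\bullet q)\bullet r$; $(p\bullet q)\circ r=(p\circ(q\bullet r))\bullet(q\circ r)$; $p\circ q=(p\circ(q\bullet r))\circ(q\circ r)$. Let $D_H:\mathbf{Set}\to\mathbf{Set}$ be the finitary monad of the algebraic theory with one binary operation $\oplus_p$ for each $p\in H$ and, for all $p,q\in H$, the equations $x\oplus_p x=x$; $x\oplus_p y=y\oplus_{p^*}x$; $(x\oplus_p y)\oplus_q(u\oplus_p v)=(x\oplus_q u)\oplus_p(y\oplus_q v)$; $(x\oplus_q y)\oplus_p z=x\oplus_{p\bullet q}(y\oplus_{p\circ q}z)$. That is, $D_H X$ is the set of terms with variables in $X$ modulo provable equality, the unit is inclusion of variables, and the multiplication is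 substitution. **Theorem.** For every symmetric tricocycloid $H$, the Kleisli category of $D_H$ is a Markov category, i.e. a symmetric monoidal category in which every object carries a commutative comonoid (copy and discard maps) compatible with the tensor, and discarding is natural. Here the tensor of objects is the cartesian product of sets; the tensor of $f:X_1\to D_H Y_1$ and $g:X_2\to D_H Y_2$ sends $(x_1,x_2)$ to the term obtained from $f(x_1)$ by substituting for each variable $a\in Y_1$ the term $g(x_2)$ with each variable $b\in Y_2$ renamed to $(a,b)$; and the associators, unitors, symmetries, copy maps and discard maps are the images of those of $(\mathbf{Set},\times,1)$ under the canonical functor from $\mathbf{Set}$ to the Kleisli category. Moreover, it has conditionals: for every $f:A\to X\otimes Y$ there is $c:X\otimes A\to Y$ such that $$f=\mathrm{copy}_A \,;\, (f_X\otimes \mathrm{id}_A)\,;\,(\mathrm{copy}_X\otimes\mathrm{id}_A)\,;\,(\mathrm{id}_X\otimes c),$$ where $f_X:A\to X$ is $f$ followed by discarding $Y$, and associators and unitors are omitted. -/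

import Mathlib

open CategoryTheory MonoidalCategory ComonObj

universe u

/-- A symmetric tricocycloid: a set with four binary operations `•`, `∘`, `•⁻¹`, `∘⁻¹`
and a unary operation `*`, satisfying eight equations. -/
class SymmetricTricocycloid (H : Type u) where
  /-- `p • q` -/
  bullet : H → H → H
  /-- `p ∘ q` -/
  circ : H → H → H
  /-- `p •⁻¹ q` -/
  bulletInv : H → H → H
  /-- `p ∘⁻¹ q` -/
  circInv : H → H → H
  /-- `p*` -/
  star : H → H
  star_star : ∀ p, star (star p) = p
  bulletInv_bullet_circ : ∀ p q, bulletInv (bullet p q) (circ p q) = p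
  circInv_bullet_circ : ∀ p q, circInv (bullet p q) (circ p q) = q
  star_bullet_bullet_circ : ∀ p q, bullet (star (bullet p q)) (circ p q) = bullet p (star q)
  star_bullet_circ_circ : ∀ p q, circ (star (bullet p q)) (circ p q) = star (circ p (star q))
  bullet_assoc : ∀ p q r, bullet p (bullet q r) = bullet (bullet p q) r
  bullet_circ : ∀ p q r, circ (bullet p q) r = bullet (circ p (bullet q r)) (circ q r)
  circ_eq : ∀ p q r, circ p q = circ (circ p (bullet q r)) (circ q r)

namespace SymmetricTricocycloid

/-- Terms of the signature with one binary operation `⊕_p` for each `p : H`,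
with variables in `X`. -/
inductive GuardTerm (H X : Type u) : Type u
  | var : X → GuardTerm H X
  | op : H → GuardTerm H X → GuardTerm H X → GuardTerm H X

/-- Provable equality of terms: the least congruence that contains all instances of
idempotency, commutativity, interchange and associativity. -/
inductive ProvablyEq (H : Type u) [SymmetricTricocycloid H] {X : Type u} :
    GuardTerm H X → GuardTerm H X → Prop
  | refl (s) : ProvablyEq H s s
  | symm {s t} : ProvablyEq H s t → ProvablyEq H t s
  | trans {s t w} : ProvablyEq H s t → ProvablyEq H t w → ProvablyEq H s w
  | congr (p : H) {s s' t t'} : ProvablyEq H s s' → ProvablyEq H t t' →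
      ProvablyEq H (.op p s t) (.op p s' t')
  | idem (p : H) (x) : ProvablyEq H (.op p x x) x
  | comm (p : H) (x y) : ProvablyEq H (.op p x y) (.op (star p) y x)
  | interchange (p q : H) (x y w v) :
      ProvablyEq H (.op q (.op p x y) (.op p w v)) (.op p (.op q x w) (.op q y v))
  | assoc (p q : H) (x y z) :
      ProvablyEq H (.op p (.op q x y) z) (.op (bullet p q) x (.op (circ p q) y z))

/-- Provable equality as a setoid. -/
def provablyEqSetoid (H : Type u) [SymmetricTricocycloid H] (X : Type u) :
    Setoid (GuardTerm H X) where
  r := ProvablyEq H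
  iseqv := ⟨ProvablyEq.refl, ProvablyEq.symm, ProvablyEq.trans⟩

/-- The set `D_H X` of terms with variables in `X`, up to provable equality. -/
def Dist (H : Type u) [SymmetricTricocycloid H] (X : Type u) : Type u :=
  Quotient (provablyEqSetoid H X)

namespace Dist

variable {H : Type u} [SymmetricTricocycloid H]

/-- The class of a variable. -/
def var {X : Type u} (x : X) : Dist H X :=
  Quotient.mk (provablyEqSetoid H X) (.var x)

/-- The operation `⊕_p` on `D_H X`. -/
def op {X : Type u} (p : H) : Dist H X → Dist H X → Dist H X :=
  Quotient.map₂ (GuardTerm.op p) (fun _ _ hs _ _ ht => ProvablyEq.congr p hs ht)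

/-- Substitution of classes of terms for the variables of a term. -/
def substTerm {X Y : Type u} (f : X → Dist H Y) : GuardTerm H X → Dist H Y
  | .var x => f x
  | .op p s t => op p (substTerm f s) (substTerm f t)

theorem substTerm_eq {X Y : Type u} (f : X → Dist H Y) {s t : GuardTerm H X}
    (h : ProvablyEq H s t) : substTerm f s = substTerm f t := by
  induction h with
  | refl => rfl
  | symm _ ih => exact ih.symm
  | trans _ _ ih₁ ih₂ => exact ih₁.trans ih₂
  | congr p _ _ ih₁ ih₂ => simp only [substTerm, ih₁, ih₂]
  | idem p x =>
    simp only [substTerm]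
    induction substTerm f x using Quotient.inductionOn with | _ a
    exact Quotient.sound (ProvablyEq.idem p a)
  | comm p x y =>
    simp only [substTerm]
    induction substTerm f x using Quotient.inductionOn with | _ a
    induction substTerm f y using Quotient.inductionOn with | _ b
    exact Quotient.sound (ProvablyEq.comm p a b)
  | interchange p q x y w v =>
    simp only [substTerm]
    induction substTerm f x using Quotient.inductionOn with | _ a
    induction substTerm f y using Quotient.inductionOn with | _ b
    induction substTerm f w using Quotient.inductionOn with | _ c
    induction substTerm f v using Quotient.inductionOn with | _ d
    exact Quotient.sound (ProvablyEq.interchange p q a b c d)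
  | assoc p q x y z =>
    simp only [substTerm]
    induction substTerm f x using Quotient.inductionOn with | _ a
    induction substTerm f y using Quotient.inductionOn with | _ b
    induction substTerm f z using Quotient.inductionOn with | _ c
    exact Quotient.sound (ProvablyEq.assoc p q a b c)

/-- Substitution `t[f]` on classes of terms. -/
def bind {X Y : Type u} (t : Dist H X) (f : X → Dist H Y) : Dist H Y :=
  Quotient.lift (substTerm f) (fun _ _ h => substTerm_eq f h) t

@[simp] theorem bind_var {X Y : Type u} (x : X) (f : X → Dist H Y) :
    bind (var (H := H) x) f = f x := rfl

@[simp] theorem bind_op {X Y : Type u} (p : H) (s t : Dist H X) (f : X → Dist H Y) :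
    bind (op p s t) f = op p (bind s f) (bind t f) := by
  induction s using Quotient.inductionOn with | _ a
  induction t using Quotient.inductionOn with | _ b
  rfl

theorem induction {X : Type u} {P : Dist H X → Prop} (hv : ∀ x, P (var x))
    (ho : ∀ p s t, P s → P t → P (op p s t)) (t : Dist H X) : P t := by
  induction t using Quotient.inductionOn with | _ a
  induction a with
  | var x => exact hv x
  | op p s t hs ht => exact ho p _ _ hs ht

theorem bind_var_right {X : Type u} (t : Dist H X) : bind t var = t := by
  induction t using Dist.induction with
  | hv x => rfl
  | ho p s t hs ht => rw [bind_op, hs, ht]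

theorem bind_assoc {X Y Z : Type u} (t : Dist H X) (f : X → Dist H Y) (g : Y → Dist H Z) :
    bind (bind t f) g = bind t (fun x => bind (f x) g) := by
  induction t using Dist.induction with
  | hv x => rfl
  | ho p s t hs ht => simp only [bind_op, hs, ht]

end Dist

/-- The finitary monad `D_H` on the category of sets: the free-model monad of the algebraic
theory with operations `⊕_p`. Its unit sends an element to a variable, its multiplication is
substitution. -/
def distMonad (H : Type u) [SymmetricTricocycloid H] : CategoryTheory.Monad (Type u) where
  obj X := Dist H X
  map f := ↾(fun t => Dist.bind t (fun x => Dist.var (f x)))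
  map_id X := by ext t; exact Dist.bind_var_right t
  map_comp f g := by ext t; exact (Dist.bind_assoc t (fun x => .var (f x)) (fun y => .var (g y))).symm
  η := { app := fun X => ↾(fun x => Dist.var x), naturality := fun _ _ _ => rfl }
  μ :=
    { app := fun X => ↾(fun t => Dist.bind t id)
      naturality := fun _ _ f => by
        ext t
        exact (Dist.bind_assoc t (fun x => .var (Dist.bind x (fun y => .var (f y)))) id).trans
          (Dist.bind_assoc t id (fun y => .var (f y))).symm }
  assoc X := by
    ext t
    exact (Dist.bind_assoc t (fun x => .var (Dist.bind x id)) id).trans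
      (Dist.bind_assoc t id id).symm
  left_unit X := rfl
  right_unit X := by
    ext t
    exact (Dist.bind_assoc t (fun x => .var (.var x : Dist H X)) id).trans (Dist.bind_var_right t)

end SymmetricTricocycloid

/-- The data, without axioms, of a symmetric monoidal category with copy and discard maps. -/
structure CopyDiscardData (C : Type*) [Category C] extends MonoidalCategoryStruct C where
  /-- The symmetry. -/
  braiding (X Y : C) : tensorObj X Y ≅ tensorObj Y X
  /-- The copy maps. -/
  copy (X : C) : X ⟶ tensorObj X X
  /-- The discard maps. -/
  discard (X : C) : X ⟶ tensorUnit

/-- The data underlying a copy-discard category. -/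
def CopyDiscardData.of (C : Type*) [Category C] [MonoidalCategory C] [CopyDiscardCategory C] :
    CopyDiscardData C where
  toMonoidalCategoryStruct := inferInstance
  braiding X Y := β_ X Y
  copy X := Δ[X]
  discard X := ε[X]

/-- A Markov category has conditionals if for every `f : A ⟶ X ⊗ Y` there is
`c : X ⊗ A ⟶ Y` such that `f` is the composite: copy `A`, apply to the first copy the
`X`-marginal of `f`, copy the resulting `X`, and apply `c` to one copy of `X` and the
remaining copy of `A`. -/
def HasConditionals (C : Type*) [Category C] [MonoidalCategory C] [MarkovCategory C] : Prop :=
  ∀ (A X Y : C) (f : A ⟶ X ⊗ Y), ∃ c : X ⊗ A ⟶ Y,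
    f = Δ[A] ≫ ((f ≫ (X ◁ ε[Y]) ≫ (ρ_ X).hom) ▷ A) ≫ (Δ[X] ▷ A) ≫ (α_ X X A).hom ≫ (X ◁ c)

namespace SymmetricTricocycloid

/-- The Kleisli category of `D_H`. -/
abbrev Channels (H : Type u) [SymmetricTricocycloid H] : Type (u + 1) :=
  Kleisli (distMonad H)

namespace Channels

variable (H : Type u) [SymmetricTricocycloid H]

/-- The inclusion of sets and functions into the Kleisli category. -/
abbrev incl : Type u ⥤ Channels H := Kleisli.Adjunction.toKleisli (distMonad H)

variable {H}

/-- The tensor product of two channels: `(x, y)` is sent to `f(x)[a ↦ g(y)[b ↦ (a, b)]]`. -/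
def tensor {X₁ Y₁ X₂ Y₂ : Channels H} (f : X₁ ⟶ Y₁) (g : X₂ ⟶ Y₂) :
    Kleisli.mk (distMonad H) (X₁.of × X₂.of) ⟶ Kleisli.mk (distMonad H) (Y₁.of × Y₂.of) :=
  .mk (↾(fun x : X₁.of × X₂.of =>
    (Dist.bind (f.of x.1) (fun a => Dist.bind (g.of x.2) (fun b => Dist.var (a, b))) :
      Dist H (Y₁.of × Y₂.of))))

variable (H)

/-- The symmetric monoidal and copy-discard data on the Kleisli category of `D_H`: on objects
the cartesian product of sets, on morphisms the product of channels, with structure maps,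
copying and discarding inherited from the cartesian category of sets. -/
def copyDiscardData : CopyDiscardData (Channels H) where
  tensorObj X Y := .mk _ (X.of × Y.of)
  tensorUnit := .mk _ PUnit
  whiskerLeft X _ _ g := tensor (𝟙 X) g
  whiskerRight f Y := tensor f (𝟙 Y)
  tensorHom f g := tensor f g
  associator X Y Z := (incl H).mapIso (α_ X.of Y.of Z.of)
  leftUnitor X := (incl H).mapIso (λ_ X.of)
  rightUnitor X := (incl H).mapIso (ρ_ X.of)
  braiding X Y := (incl H).mapIso (β_ X.of Y.of)
  copy X := (incl H).map (↾(fun x : X.of => (x, x)))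
  discard X := (incl H).map (↾(fun _ : X.of => PUnit.unit))

end Channels

end SymmetricTricocycloid

namespace SymmetricTricocycloid

variable {H : Type u} [SymmetricTricocycloid H]

/-! Idempotency makes every constant substitution trivial (`bind_const`), so discarding is natural.
Interchange makes `D_H` a commutative monad (`bind_comm`), so the tensor is functorial; the
remaining coherence is inherited from sets. Conditionals need mixtures to be regrouped freely. The
associativity equation only moves brackets to the right; since `(p, q) ↦ (p • q, p ∘ q)` is onto,
brackets also move left, with new weights. Hence in a term over `X × Y` all variables with a given
first component can be gathered on one side (`split_fst`). Repeating this over the finitely many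
first components that occur writes the term as a mixture over `X` of terms over `Y`. -/

/-- The map `(p, q) ↦ (p • q, p ∘ q)` is surjective. -/
theorem exists_bullet_eq_circ_eq (p q : H) : ∃ r s : H, bullet r s = p ∧ circ r s = q := by
  have inj : ∀ a b c d : H, bullet a b = bullet c d → circ a b = circ c d → a = c ∧ b = d := by
    intro a b c d h₁ h₂
    refine ⟨?_, ?_⟩
    · rw [← bulletInv_bullet_circ a b, h₁, h₂, bulletInv_bullet_circ]
    · rw [← circInv_bullet_circ a b, h₁, h₂, circInv_bullet_circ]
  -- With `v` the map in question and `σ`, `τ` the star on the first and second coordinate, this is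
  -- `v σ v τ = τ v`.
  have key : ∀ a b : H, bullet (star (bullet a (star b))) (circ a (star b)) = bullet a b ∧
      circ (star (bullet a (star b))) (circ a (star b)) = star (circ a b) := by
    intro a b
    have h₁ := star_bullet_bullet_circ a (star b)
    have h₂ := star_bullet_circ_circ a (star b)
    rw [star_star] at h₁ h₂
    exact ⟨h₁, h₂⟩
  -- Using `key` twice gives `v σ v τ (σ v τ σ) = v σ`; cancelling `v` by injectivity leaves `v (τ σ
  -- v τ σ) = id`. So the inverse of `v` is `v` conjugated by both stars.
  obtain ⟨h₁, h₂⟩ := key (star p) q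
  obtain ⟨h₃, h₄⟩ := key (star (bullet (star p) (star q))) (circ (star p) (star q))
  rw [h₂, star_star] at h₄
  obtain ⟨h₅, h₆⟩ := inj _ _ _ _ (h₃.trans h₁) h₄
  refine ⟨star (bullet (star p) (star q)), star (circ (star p) (star q)), ?_, h₆⟩
  rw [← star_star (bullet _ _), h₅, star_star]

namespace Dist

/-! ### Regrouping mixtures. -/

section Operations

variable {X : Type u}

theorem op_idem (p : H) (s : Dist H X) : op p s s = s := by
  induction s using Quotient.inductionOn with | _ a
  exact Quotient.sound (ProvablyEq.idem p a)

theorem op_comm (p : H) (s t : Dist H X) : op p s t = op (star p) t s := by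
  induction s using Quotient.inductionOn with | _ a
  induction t using Quotient.inductionOn with | _ b
  exact Quotient.sound (ProvablyEq.comm p a b)

theorem op_interchange (p q : H) (s t u v : Dist H X) :
    op q (op p s t) (op p u v) = op p (op q s u) (op q t v) := by
  induction s using Quotient.inductionOn with | _ a
  induction t using Quotient.inductionOn with | _ b
  induction u using Quotient.inductionOn with | _ c
  induction v using Quotient.inductionOn with | _ d
  exact Quotient.sound (ProvablyEq.interchange p q a b c d)

theorem op_assoc (p q : H) (s t u : Dist H X) :
    op p (op q s t) u = op (bullet p q) s (op (circ p q) t u) := by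
  induction s using Quotient.inductionOn with | _ a
  induction t using Quotient.inductionOn with | _ b
  induction u using Quotient.inductionOn with | _ c
  exact Quotient.sound (ProvablyEq.assoc p q a b c)

theorem exists_op_op_right_eq (p q : H) :
    ∃ p' q' : H, ∀ s t u : Dist H X, op p s (op q t u) = op p' (op q' s t) u := by
  obtain ⟨p', q', rfl, rfl⟩ := exists_bullet_eq_circ_eq p q
  exact ⟨p', q', fun s t u => (op_assoc p' q' s t u).symm⟩

theorem exists_op_left_comm (p q : H) :
    ∃ p' q' : H, ∀ s t u : Dist H X, op p s (op q t u) = op p' t (op q' s u) := by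
  obtain ⟨p', q', h⟩ := exists_op_op_right_eq (X := X) p q
  exact ⟨_, _, fun s t u => by rw [h, op_comm q', op_assoc]⟩

/-- Two binary mixtures can be mixed by first mixing their components. -/
theorem exists_op_op_op_comm (p q r : H) : ∃ p' q' r' : H, ∀ s t u v : Dist H X,
    op p (op q s t) (op r u v) = op p' (op q' s u) (op r' t v) := by
  -- Interchange does not apply, as `q` and `r` may differ. Instead: bracket to the right, move `u`
  -- past `t`, then bracket `s` with `u`.
  obtain ⟨a, b, h⟩ := exists_op_left_comm (X := X) (circ p q) r
  obtain ⟨c, d, h'⟩ := exists_op_op_right_eq (X := X) (bullet p q) a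
  exact ⟨c, d, b, fun s t u v => by rw [op_assoc, h, h']⟩

end Operations

/-! ### Affineness and commutativity of the monad. -/

theorem bind_const {X Y : Type u} (s : Dist H X) (t : Dist H Y) : (s.bind fun _ => t) = t := by
  induction s using Dist.induction with
  | hv x => rfl
  | ho p s₁ s₂ h₁ h₂ => rw [bind_op, h₁, h₂, op_idem]

theorem bind_op_fun {X Y : Type u} (p : H) (s : Dist H X) (f g : X → Dist H Y) :
    (s.bind fun x => op p (f x) (g x)) = op p (s.bind f) (s.bind g) := by
  induction s using Dist.induction with
  | hv x => rfl
  | ho q s₁ s₂ h₁ h₂ => simp only [bind_op, h₁, h₂, op_interchange]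

/-- A Fubini property: interchange, through `bind_op_fun`, lets each operation of `s` pass through
the substitution into `t`. -/
theorem bind_comm {X Y Z : Type u} (s : Dist H X) (t : Dist H Y) (k : X → Y → Dist H Z) :
    (s.bind fun x => t.bind (k x)) = t.bind fun y => s.bind fun x => k x y := by
  induction s using Dist.induction with
  | hv x => rfl
  | ho p s₁ s₂ h₁ h₂ => simp only [bind_op, h₁, h₂, bind_op_fun]

/-! ### Supports and disintegration. -/

/-- `t.SupportedOn S` means that `t` is represented by a term all of whose variables
lie in `S`. -/
inductive SupportedOn {X : Type u} (S : Set X) : Dist H X → Prop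
  | var {x} : x ∈ S → SupportedOn S (var x)
  | op (p) {s t} : SupportedOn S s → SupportedOn S t → SupportedOn S (op p s t)

namespace SupportedOn

variable {X Y : Type u}

theorem mono {S T : Set X} (h : S ⊆ T) {t : Dist H X} (ht : t.SupportedOn S) :
    t.SupportedOn T := by
  induction ht with
  | var hx => exact var (h hx)
  | op p _ _ h₁ h₂ => exact op p h₁ h₂

theorem exists_finite (t : Dist H X) : ∃ S : Set X, S.Finite ∧ t.SupportedOn S := by
  induction t using Dist.induction with
  | hv x => exact ⟨{x}, Set.finite_singleton x, var rfl⟩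
  | ho p s t hs ht =>
    obtain ⟨S, hS, hs⟩ := hs
    obtain ⟨T, hT, ht⟩ := ht
    exact ⟨S ∪ T, hS.union hT, op p (hs.mono Set.subset_union_left)
      (ht.mono Set.subset_union_right)⟩

/-- The signature has no constants, so every term contains a variable. -/
theorem not_empty (t : Dist H X) : ¬ t.SupportedOn ∅ := by
  intro h
  generalize hS : (∅ : Set X) = S at h
  induction h with
  | var hx => exact (hS ▸ hx : _ ∈ (∅ : Set X))
  | op p _ _ h₁ _ => exact h₁

theorem bind_congr {S : Set X} {t : Dist H X} (ht : t.SupportedOn S) {f g : X → Dist H Y}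
    (h : ∀ x ∈ S, f x = g x) : t.bind f = t.bind g := by
  induction ht with
  | var hx => exact h _ hx
  | op p _ _ h₁ h₂ => rw [bind_op, bind_op, h₁, h₂]

end SupportedOn

/-- The term obtained from `t` by renaming each variable `y` to `(x, y)`. -/
def pair {X Y : Type u} (x : X) (t : Dist H Y) : Dist H (X × Y) :=
  t.bind fun y => var (x, y)

theorem pair_op {X Y : Type u} (x : X) (p : H) (s t : Dist H Y) :
    pair x (op p s t) = op p (pair x s) (pair x t) := bind_op p s t _

/-- Splitting a term according to whether the first component of the variables is `x`. -/
theorem split_fst {X Y : Type u} (x : X) {S : Set X} {t : Dist H (X × Y)}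
    (ht : t.SupportedOn (Prod.fst ⁻¹' insert x S)) :
    (∃ d, t = pair x d) ∨ t.SupportedOn (Prod.fst ⁻¹' S) ∨
      ∃ (p : H) (d : Dist H Y) (s : Dist H (X × Y)), s.SupportedOn (Prod.fst ⁻¹' S) ∧
        t = op p (pair x d) s := by
  induction ht with
  | @var z hz =>
    obtain ⟨z₁, z₂⟩ := z
    rcases hz with rfl | hz
    · exact .inl ⟨.var z₂, rfl⟩
    · exact .inr (.inl (.var hz))
  | op p _ _ h₁ h₂ =>
    -- No weight need ignore one of its arguments, so the pure cases cannot be absorbed into the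
    -- mixed one. In each combination the parts over `x` are gathered on the left.
    rcases h₁ with ⟨d₁, rfl⟩ | h₁ | ⟨q₁, d₁, s₁, h₁, rfl⟩ <;>
      rcases h₂ with ⟨d₂, rfl⟩ | h₂ | ⟨q₂, d₂, s₂, h₂, rfl⟩
    · exact .inl ⟨op p d₁ d₂, (pair_op x p d₁ d₂).symm⟩
    · exact .inr (.inr ⟨p, d₁, _, h₂, rfl⟩)
    · obtain ⟨a, b, h⟩ := exists_op_op_right_eq (X := X × Y) p q₂
      exact .inr (.inr ⟨a, op b d₁ d₂, s₂, h₂, by rw [h, pair_op]⟩)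
    · exact .inr (.inr ⟨star p, d₂, _, h₁, op_comm _ _ _⟩)
    · exact .inr (.inl (.op p h₁ h₂))
    · obtain ⟨a, b, h⟩ := exists_op_left_comm (X := X × Y) p q₂
      exact .inr (.inr ⟨a, d₂, _, .op b h₁ h₂, by rw [h]⟩)
    · obtain ⟨a, b, h⟩ := exists_op_op_right_eq (X := X × Y) (star p) q₁
      exact .inr (.inr ⟨a, op b d₂ d₁, s₁, h₁, by rw [op_comm, h, pair_op]⟩)
    · exact .inr (.inr ⟨_, d₁, _, .op _ h₁ h₂, op_assoc _ _ _ _ _⟩)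
    · obtain ⟨a, b, c, h⟩ := exists_op_op_op_comm (X := X × Y) p q₁ q₂
      exact .inr (.inr ⟨a, op b d₁ d₂, _, .op c h₁ h₂, by rw [h, pair_op]⟩)

/-- Induction on `S`, peeling off one first component at a time. Keeping `r` supported on `S` makes
the values of `c` elsewhere irrelevant, so `c` can be redefined at a new point. -/
theorem exists_disintegration_of_supportedOn {X Y : Type u} {S : Set X} (hS : S.Finite)
    (t : Dist H (X × Y)) (ht : t.SupportedOn (Prod.fst ⁻¹' S)) :
    ∃ (r : Dist H X) (c : X → Dist H Y), r.SupportedOn S ∧ t = r.bind fun x => pair x (c x) := by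
  classical
  induction S, hS using Set.Finite.induction_on generalizing t with
  | empty => exact absurd ht (SupportedOn.not_empty t)
  | @insert x S hx _ ih =>
    rcases split_fst x ht with ⟨d, rfl⟩ | ht | ⟨p, d, s, hs, rfl⟩
    -- `Dist H Y` may have no canonical element; `d` serves as the default value off the support.
    · exact ⟨var x, fun _ => d, .var (Set.mem_insert x S), rfl⟩
    · obtain ⟨r, c, hr, h⟩ := ih t ht
      exact ⟨r, c, hr.mono (Set.subset_insert x S), h⟩
    · obtain ⟨r, c, hr, rfl⟩ := ih s hs
      refine ⟨op p (var x) r, Function.update c x d,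
        .op p (.var (Set.mem_insert x S)) (hr.mono (Set.subset_insert x S)), ?_⟩
      rw [bind_op, bind_var, Function.update_self]
      congr 1
      refine hr.bind_congr fun y hy => ?_
      rw [Function.update_of_ne (ne_of_mem_of_not_mem hy hx)]

/-- Every joint distribution is the mixture of conditional distributions over its first
marginal. -/
theorem exists_conditional {X Y : Type u} (t : Dist H (X × Y)) :
    ∃ c : X → Dist H Y, t = (t.bind fun z => var z.1).bind fun x => pair x (c x) := by
  obtain ⟨T, hT, ht⟩ := SupportedOn.exists_finite t
  obtain ⟨r, c, -, h⟩ := exists_disintegration_of_supportedOn (hT.image Prod.fst) t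
    (ht.mono (Set.subset_preimage_image _ _))
  refine ⟨c, ?_⟩
  -- The mixing term `r` is forced: forgetting `Y` turns each `pair x (c x)` into `var x` by
  -- `bind_const`.
  have marginal : (t.bind fun z => var z.1) = r := by
    rw [h, bind_assoc]
    refine Eq.trans ?_ (bind_var_right r)
    congr 1
    funext x
    rw [pair, bind_assoc]
    exact bind_const (c x) (var x)
  rw [marginal, ← h]

end Dist

/-! ### The Markov structure and its conditionals. -/

namespace Channels

/-- The value of a channel at a point. -/
def app {X Y : Channels H} (f : X ⟶ Y) (x : X.of) : Dist H Y.of := f.of x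

theorem ext_app {X Y : Channels H} {f g : X ⟶ Y} (h : ∀ x, app f x = app g x) : f = g := by
  apply Kleisli.hom_ext
  ext x
  exact h x

theorem app_comp {X Y Z : Channels H} (f : X ⟶ Y) (g : Y ⟶ Z) (x : X.of) :
    app (f ≫ g) x = (app f x).bind (app g) :=
  Dist.bind_assoc (f.of x) (fun y => .var (g.of y : Dist H Z.of)) id

theorem app_tensor {X₁ Y₁ X₂ Y₂ : Channels H} (f : X₁ ⟶ Y₁) (g : X₂ ⟶ Y₂)
    (x : X₁.of × X₂.of) : app (tensor f g) x =
      (app f x.1).bind fun a => (app g x.2).bind fun b => .var (a, b) := rfl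

theorem tensor_comp_tensor {X₁ Y₁ Z₁ X₂ Y₂ Z₂ : Channels H} (f₁ : X₁ ⟶ Y₁) (f₂ : X₂ ⟶ Y₂)
    (g₁ : Y₁ ⟶ Z₁) (g₂ : Y₂ ⟶ Z₂) :
    tensor f₁ f₂ ≫ tensor g₁ g₂ = tensor (f₁ ≫ g₁) (f₂ ≫ g₂) := by
  refine ext_app fun x => ?_
  simp only [app_comp, app_tensor, Dist.bind_assoc, Dist.bind_var]
  congr 1
  funext a
  -- The two sides differ only in the order of the independent substitutions `f₂` and `g₁`.
  exact Dist.bind_comm _ _ _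

/-- The monoidal structure on the Kleisli category of `D_H`. -/
abbrev monoidalCategory (H : Type u) [SymmetricTricocycloid H] :
    MonoidalCategory (Channels H) where
  toMonoidalCategoryStruct := (copyDiscardData H).toMonoidalCategoryStruct
  tensorHom_def {X₁ Y₁ X₂ Y₂} f g := by
    refine Eq.trans ?_ (tensor_comp_tensor f (𝟙 X₂) (𝟙 Y₁) g).symm
    rw [Category.comp_id, Category.id_comp]
    rfl
  id_tensorHom_id _ _ := ext_app fun _ => rfl
  tensorHom_comp_tensorHom := tensor_comp_tensor
  whiskerLeft_id _ _ := ext_app fun _ => rfl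
  id_whiskerRight _ _ := ext_app fun _ => rfl
  associator_naturality {X₁ X₂ X₃ Y₁ Y₂ Y₃} f₁ f₂ f₃ := by
    refine ext_app fun x => ?_
    refine (app_comp _ _ _).trans (Eq.trans ?_ (app_comp _ _ _).symm)
    change Dist.bind (Dist.bind (Dist.bind (app f₁ x.1.1) fun a =>
        Dist.bind (app f₂ x.1.2) fun b => .var (a, b)) fun z =>
        Dist.bind (app f₃ x.2) fun c => .var (z, c)) (fun z => .var (z.1.1, z.1.2, z.2)) =
      Dist.bind (app f₁ x.1.1) fun a => Dist.bind (Dist.bind (app f₂ x.1.2) fun b =>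
        Dist.bind (app f₃ x.2) fun c => .var (b, c)) fun z => .var (a, z)
    simp only [Dist.bind_assoc, Dist.bind_var]
  leftUnitor_naturality {X Y} f := by
    refine ext_app fun x => ?_
    refine (app_comp _ _ _).trans (Eq.trans ?_ (app_comp _ _ _).symm)
    change Dist.bind (Dist.bind (app f x.2) fun b => .var (x.1, b)) (fun z => .var z.2) =
      app f x.2
    simp only [Dist.bind_assoc, Dist.bind_var, Dist.bind_var_right]
  rightUnitor_naturality {X Y} f := by
    refine ext_app fun x => ?_
    refine (app_comp _ _ _).trans (Eq.trans ?_ (app_comp _ _ _).symm)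
    change Dist.bind (Dist.bind (app f x.1) fun a => .var (a, x.2)) (fun z => .var z.1) =
      app f x.1
    simp only [Dist.bind_assoc, Dist.bind_var, Dist.bind_var_right]
  pentagon _ _ _ _ := ext_app fun _ => rfl
  triangle _ _ := ext_app fun _ => rfl

section

attribute [local instance] monoidalCategory

/-- The symmetry on the Kleisli category of `D_H`. -/
abbrev symmetricCategory (H : Type u) [SymmetricTricocycloid H] :
    SymmetricCategory (Channels H) where
  braiding := (copyDiscardData H).braiding
  braiding_naturality_right X {Y Z} f := by
    refine ext_app fun x => ?_
    refine (app_comp _ _ _).trans (Eq.trans ?_ (app_comp _ _ _).symm)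
    change Dist.bind (Dist.bind (app f x.2) fun b => .var (x.1, b)) (fun z => .var (z.2, z.1)) =
      Dist.bind (app f x.2) fun b => .var (b, x.1)
    simp only [Dist.bind_assoc, Dist.bind_var]
  braiding_naturality_left {X Y} f Z := by
    refine ext_app fun x => ?_
    refine (app_comp _ _ _).trans (Eq.trans ?_ (app_comp _ _ _).symm)
    change Dist.bind (Dist.bind (app f x.1) fun a => .var (a, x.2)) (fun z => .var (z.2, z.1)) =
      Dist.bind (app f x.1) fun a => .var (x.2, a)
    simp only [Dist.bind_assoc, Dist.bind_var]
  hexagon_forward _ _ _ := ext_app fun _ => rfl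
  hexagon_reverse _ _ _ := ext_app fun _ => rfl
  symmetry _ _ := ext_app fun _ => rfl

/-- The comonoid structure on a set, seen as an object of the Kleisli category. -/
abbrev comonObj (X : Channels H) : ComonObj X where
  counit := (copyDiscardData H).discard X
  comul := (copyDiscardData H).copy X
  counit_comul := ext_app fun _ => rfl
  comul_counit := ext_app fun _ => rfl
  comul_assoc := ext_app fun _ => rfl

/-- The Markov structure on the Kleisli category of `D_H`. -/
abbrev markovCategory (H : Type u) [SymmetricTricocycloid H] : MarkovCategory (Channels H) where
  toSymmetricCategory := symmetricCategory H
  comonObj := comonObj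
  isCommComonObj X :=
    letI := symmetricCategory H
    letI := comonObj X
    { comul_comm := ext_app fun _ => rfl }
  copy_tensor _ _ := ext_app fun _ => rfl
  discard_tensor _ _ := ext_app fun _ => rfl
  copy_unit := ext_app fun _ => rfl
  discard_unit := ext_app fun _ => rfl
  discard_natural f := ext_app fun x =>
    (app_comp _ _ x).trans (Dist.bind_const (app f x) (.var PUnit.unit))

attribute [local instance] markovCategory

theorem hasConditionals (H : Type u) [SymmetricTricocycloid H] :
    HasConditionals (Channels H) := by
  intro A X Y f
  -- Disintegration is applied to each input `a` separately; no compatibility between different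
  -- inputs is required.
  choose c hc using fun a : A.of => Dist.exists_conditional (X := X.of) (Y := Y.of) (app f a)
  refine ⟨.mk (↾(fun z : X.of × A.of => c z.2 z.1)), ext_app fun a => ?_⟩
  refine (hc a).trans ?_
  have marginal : app (f ≫ (X ◁ ε[Y]) ≫ (ρ_ X).hom) a =
      Dist.bind (X := X.of × Y.of) (app f a) fun z => .var z.1 := app_comp _ _ a
  generalize f ≫ (X ◁ ε[Y]) ≫ (ρ_ X).hom = g at marginal ⊢
  rw [← marginal]
  refine Eq.trans ?_ (app_comp _ _ a).symm
  refine Eq.trans ?_ (app_comp _ _ (X := A ⊗ A) (a, a)).symm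
  change _ = Dist.bind (Dist.bind (app g a) fun x => .var (x, a)) _
  refine Eq.trans (congrArg (Dist.bind (app g a)) (funext fun x => Eq.symm ?_))
    (Dist.bind_assoc (app g a) (fun x => .var (x, a)) _).symm
  refine (app_comp _ _ (X := X ⊗ A) (x, a)).trans ?_
  exact app_comp _ _ (X := (X ⊗ X) ⊗ A) ((x, x), a)

end

end Channels

end SymmetricTricocycloid

theorem theorem31 (H : Type u) [SymmetricTricocycloid H] :
    ∃ (_ : MonoidalCategory (SymmetricTricocycloid.Channels H))
      (_ : MarkovCategory (SymmetricTricocycloid.Channels H)),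
      CopyDiscardData.of (SymmetricTricocycloid.Channels H) =
          SymmetricTricocycloid.Channels.copyDiscardData H ∧
        HasConditionals (SymmetricTricocycloid.Channels H) :=
  ⟨SymmetricTricocycloid.Channels.monoidalCategory H,
    SymmetricTricocycloid.Channels.markovCategory H, rfl,
    SymmetricTricocycloid.Channels.hasConditionals H⟩
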